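/- All systems are finite-dimensional. For a state $\rho_{AB}$, let \[ \mathcal F(\rho_{AB}) := \left\{ \operatorname{Tr}_B[\omega_{ABB'}] : \omega_{ABB'} \text{ a state},\ \operatorname{Tr}_{B'}[\omega_{ABB'}] = \rho_{AB} \right\}, \] where $B'$ is isomorphic to $B$ and $\operatorname{Tr}_B[\omega_{ABB'}]$ is regarded as a state of $AB$ through this isomorphism. The state $\rho_{AB}$ is called super two-extendible if there is $\sigma_{AB}\in\mathcal F(\rho_{AB})$ with $\operatorname{supp}(\sigma_{AB})\subseteq\operatorname{supp}(\rho_{AB})$. For an integer $k\ge 1$, a bipartite private state of $\log_2 k$ secret key bits is a state of the form \[ \gamma^k_{A'B'} = \frac1k\sum_{i,j=0}^{k-1}|ii\rangle\!\langle jj|_{A_0B_0}\otimes U_i\,\omega_{A_1B_1}U_j^\dagger ,\qquad A'=A_0A_1,\ B'=B_0B_1, \] where $\dim A_0=\dim B_0=k$, the systems $A_1,B_1$ are arbitrary, $\omega_{A_1B_1}$ is a state and $U_0,\dots,U_{k-1}$ are unitaries on $A_1B_1$. A one-way LOCC channel $\mathcal L^{\to}_{AB\to A'B'}$ is a map of the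 form $\sum_x \mathcal E^x_{A\to A'}\otimes\mathcal D^x_{B\to B'}$ (a finite sum), where each $\mathcal E^x$ is completely positive, $\sum_x\mathcal E^x$ is trace preserving, and each $\mathcal D^x$ is a quantum channel. The one-shot probabilistic one-way distillable secret key $K_D^{(1),\to}(\rho_{AB})$ is the supremum of $p\log_2 k$ over all $p\in[0,1]$, integers $k\ge 1$, private states $\gamma^k_{A'B'}$ and one-way LOCC channels $\mathcal L^{\to}_{AB\to X_AA'B'}$ (with $X_A$ a two-level flag held by Alice) such that \[ \mathcal L^{\to}(\rho_{AB}) = p\,|1\rangle\!\langle 1|_{X_A}\otimes\gamma^k_{A'B'} + (1-p)\,|0\rangle\!\langle 0|_{X_A}\otimes\frac{I_{A'B'}}{d_{A'}d_{B'}} . \] The probabilistic one-way distillable secret key is \[ K_D^{\to}(\rho_{AB}) := \liminf_{n\to\infty}\frac1n K_D^{(1),\to}\!\left(\rho_{AB}^{\otimes n}\right). \] \textbf{Theorem.} If $\rho_{AB}$ is a super two-extendible state, then $K_D^{\to}(\rho_{AB})=0$. -/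

import Mathlib

open scoped Kronecker ComplexOrder ENNReal

noncomputable section

namespace QKey

/-! Finite-dimensional quantum systems are described in a fixed orthonormal basis: a finite index
type `A` stands for the Hilbert space `ℂ^A`, and operators on it are `A × A` complex matrices.
The joint system of `A` and `B` has index type `A × B`. -/

/-- Quantum states (density operators): positive semidefinite operators of unit trace. -/
def IsState {S : Type*} [Fintype S] (ρ : Matrix S S ℂ) : Prop :=
  ρ.PosSemidef ∧ ρ.trace = 1

/-- The support of a (Hermitian) operator: its range, i.e. the orthogonal complement of its
kernel. -/
def supp {S : Type*} [Fintype S] (ρ : Matrix S S ℂ) : Submodule ℂ (S → ℂ) :=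
  LinearMap.range ρ.mulVecLin

/-- The pure state `[i] = |i⟩⟨i|`. -/
def proj {S : Type*} [DecidableEq S] (i : S) : Matrix S S ℂ :=
  Matrix.single i i 1

/-- The marginal `Tr_{B'}[ω_{ABB'}]` on `AB`. -/
def traceB' {A B : Type*} [Fintype B] (ω : Matrix (A × B × B) (A × B × B) ℂ) :
    Matrix (A × B) (A × B) ℂ :=
  Matrix.of fun x y => ∑ c : B, ω (x.1, x.2, c) (y.1, y.2, c)

/-- The marginal `Tr_B[ω_{ABB'}]` on `AB'`, with `B'` identified with `B`. -/
def traceB {A B : Type*} [Fintype B] (ω : Matrix (A × B × B) (A × B × B) ℂ) :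
    Matrix (A × B) (A × B) ℂ :=
  Matrix.of fun x y => ∑ c : B, ω (x.1, c, x.2) (y.1, c, y.2)

/-- The set `F(ρ_{AB})` of all `Tr_B[ω_{ABB'}]`, where `ω_{ABB'}` ranges over the states that
extend `ρ_{AB}`, with `B'` isomorphic to `B`. -/
def extensionSet {A B : Type*} [Fintype A] [Fintype B] (ρ : Matrix (A × B) (A × B) ℂ) :
    Set (Matrix (A × B) (A × B) ℂ) :=
  {σ | ∃ ω : Matrix (A × B × B) (A × B × B) ℂ, IsState ω ∧ traceB' ω = ρ ∧ traceB ω = σ}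

/-- Super two-extendible states. -/
def IsSuperTwoExtendible {A B : Type*} [Fintype A] [Fintype B]
    (ρ : Matrix (A × B) (A × B) ℂ) : Prop :=
  ∃ σ ∈ extensionSet ρ, supp σ ≤ supp ρ

/-- The operator `(id_n ⊗ Φ)(X)`, i.e. `Φ` applied to each block of `X`. -/
def ampliation {S T : Type*} (Φ : Matrix S S ℂ →ₗ[ℂ] Matrix T T ℂ) (n : ℕ)
    (X : Matrix (Fin n × S) (Fin n × S) ℂ) : Matrix (Fin n × T) (Fin n × T) ℂ :=
  Matrix.of fun x y => Φ (Matrix.of fun s t => X (x.1, s) (y.1, t)) x.2 y.2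

/-- Complete positivity: `id_n ⊗ Φ` preserves positive semidefiniteness for every `n`. -/
def IsCP {S T : Type*} (Φ : Matrix S S ℂ →ₗ[ℂ] Matrix T T ℂ) : Prop :=
  ∀ (n : ℕ) (X : Matrix (Fin n × S) (Fin n × S) ℂ), X.PosSemidef → (ampliation Φ n X).PosSemidef

/-- Trace preservation. -/
def IsTP {S T : Type*} [Fintype S] [Fintype T] (Φ : Matrix S S ℂ →ₗ[ℂ] Matrix T T ℂ) : Prop :=
  ∀ X, (Φ X).trace = X.trace

/-- Quantum channels: completely positive, trace-preserving linear maps. -/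
def IsChannel {S T : Type*} [Fintype S] [Fintype T]
    (Φ : Matrix S S ℂ →ₗ[ℂ] Matrix T T ℂ) : Prop :=
  IsCP Φ ∧ IsTP Φ

section Tensor

variable {A A' B B' : Type*} [Fintype A] [DecidableEq A] [Fintype B] [DecidableEq B]

/-- The tensor product `E ⊗ D` of linear maps on operators: the linear map with
`|a⟩⟨c| ⊗ |b⟩⟨d| ↦ E(|a⟩⟨c|) ⊗ D(|b⟩⟨d|)`. -/
def tensorMap (E : Matrix A A ℂ →ₗ[ℂ] Matrix A' A' ℂ) (D : Matrix B B ℂ →ₗ[ℂ] Matrix B' B' ℂ) :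
    Matrix (A × B) (A × B) ℂ →ₗ[ℂ] Matrix (A' × B') (A' × B') ℂ where
  toFun X := ∑ x : A × B, ∑ y : A × B,
    X x y • (E (Matrix.single x.1 y.1 1) ⊗ₖ D (Matrix.single x.2 y.2 1))
  map_add' X Y := by
    simp only [Matrix.add_apply, add_smul, Finset.sum_add_distrib]
  map_smul' c X := by
    simp only [Matrix.smul_apply, smul_eq_mul, mul_smul, Finset.smul_sum, RingHom.id_apply]

end Tensor

/-- One-way LOCC channels (from Alice to Bob) `AB → A'B'`: Alice performs a quantum instrument
`(E_x)_x` with finitely many outcomes and sends the outcome `x` to Bob, who applies the channel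
`D_x`. Thus `L = ∑ x, E_x ⊗ D_x` with every `E_x` completely positive, `∑ x, E_x` trace preserving,
and every `D_x` a channel. -/
def IsOneWayLOCC {A B A' B' : Type*} [Fintype A] [DecidableEq A] [Fintype B] [DecidableEq B]
    [Fintype A'] [Fintype B']
    (L : Matrix (A × B) (A × B) ℂ →ₗ[ℂ] Matrix (A' × B') (A' × B') ℂ) : Prop :=
  ∃ (m : ℕ) (E : Fin m → (Matrix A A ℂ →ₗ[ℂ] Matrix A' A' ℂ))
    (D : Fin m → (Matrix B B ℂ →ₗ[ℂ] Matrix B' B' ℂ)),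
    (∀ x, IsCP (E x)) ∧ IsTP (∑ x, E x) ∧ (∀ x, IsChannel (D x)) ∧
      L = ∑ x, tensorMap (E x) (D x)

/-- Bipartite private states `γ^k` of `log₂ k` secret key bits with key systems `A₀, B₀` of
dimension `k` and shield systems `A₁, B₁` of dimensions `a, b`, where Alice holds `A₀A₁` and Bob
holds `B₀B₁`:
`γ^k = (1/k) ∑ i j, |ii⟩⟨jj|_{A₀B₀} ⊗ (U_i ω_{A₁B₁} U_j†)` for a state `ω` and unitaries `U_i`.
The submatrix regroups `A₀A₁B₀B₁` from `(A₀B₀)(A₁B₁)`. -/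
def IsPrivateState (k a b : ℕ)
    (γ : Matrix ((Fin k × Fin a) × (Fin k × Fin b)) ((Fin k × Fin a) × (Fin k × Fin b)) ℂ) :
    Prop :=
  1 ≤ k ∧ ∃ (ω : Matrix (Fin a × Fin b) (Fin a × Fin b) ℂ)
    (U : Fin k → Matrix.unitaryGroup (Fin a × Fin b) ℂ),
    IsState ω ∧
      γ = ((k : ℂ)⁻¹ • ∑ i : Fin k, ∑ j : Fin k,
        Matrix.single (i, i) (j, j) (1 : ℂ) ⊗ₖ
          ((U i : Matrix (Fin a × Fin b) (Fin a × Fin b) ℂ) * ω *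
            (U j : Matrix (Fin a × Fin b) (Fin a × Fin b) ℂ).conjTranspose)).submatrix
        (Equiv.prodProdProdComm (Fin k) (Fin a) (Fin k) (Fin b))
        (Equiv.prodProdProdComm (Fin k) (Fin a) (Fin k) (Fin b))

/-- The maximally mixed state `I / d`. -/
def maxMixed (S : Type*) [Fintype S] [DecidableEq S] : Matrix S S ℂ :=
  (Fintype.card S : ℂ)⁻¹ • (1 : Matrix S S ℂ)

/-- The flagged state `p [1]_X ⊗ γ_{A'B'} + (1 - p) [0]_X ⊗ I_{A'B'} / (d_{A'} d_{B'})`, where the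
classical flag `X` belongs to Alice. -/
def flagged {A' B' : Type*} [Fintype A'] [DecidableEq A'] [Fintype B'] [DecidableEq B'] (p : ℝ)
    (γ : Matrix (A' × B') (A' × B') ℂ) :
    Matrix ((Fin 2 × A') × B') ((Fin 2 × A') × B') ℂ :=
  ((p : ℂ) • (proj (1 : Fin 2) ⊗ₖ γ) +
      ((1 - p : ℝ) : ℂ) • (proj (0 : Fin 2) ⊗ₖ maxMixed (A' × B'))).submatrix
    (Equiv.prodAssoc (Fin 2) A' B') (Equiv.prodAssoc (Fin 2) A' B')

/-- One-shot probabilistic one-way distillable secret key: the supremum of `p log₂ k` over all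
`p ∈ [0,1]`, `k`, private states `γ^k` (with arbitrary shields) and one-way LOCC channels `L` such
that `L(ρ) = p [1] ⊗ γ^k + (1 - p) [0] ⊗ I / d`. -/
def oneShotKey {A B : Type*} [Fintype A] [DecidableEq A] [Fintype B] [DecidableEq B]
    (ρ : Matrix (A × B) (A × B) ℂ) : ℝ≥0∞ :=
  sSup {r : ℝ≥0∞ | ∃ (p : ℝ) (k a b : ℕ)
    (γ : Matrix ((Fin k × Fin a) × (Fin k × Fin b)) ((Fin k × Fin a) × (Fin k × Fin b)) ℂ)
    (L : Matrix (A × B) (A × B) ℂ →ₗ[ℂ]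
      Matrix ((Fin 2 × (Fin k × Fin a)) × (Fin k × Fin b))
        ((Fin 2 × (Fin k × Fin a)) × (Fin k × Fin b)) ℂ),
    0 ≤ p ∧ p ≤ 1 ∧ IsPrivateState k a b γ ∧ IsOneWayLOCC L ∧ L ρ = flagged p γ ∧
      r = ENNReal.ofReal (p * Real.logb 2 k)}

/-- The `n`-fold tensor power `ρ_{AB}^{⊗ n}`, as a bipartite operator on `Aⁿ` and `Bⁿ`. -/
def tensorPower {A B : Type*} (n : ℕ) (ρ : Matrix (A × B) (A × B) ℂ) :
    Matrix ((Fin n → A) × (Fin n → B)) ((Fin n → A) × (Fin n → B)) ℂ :=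
  Matrix.of fun x y => ∏ i : Fin n, ρ (x.1 i, x.2 i) (y.1 i, y.2 i)

/-- Probabilistic one-way distillable secret key:
`liminf_{n → ∞} (1/n) oneShotKey (ρ^{⊗ n})`. -/
def distillableKey {A B : Type*} [Fintype A] [DecidableEq A] [Fintype B] [DecidableEq B]
    (ρ : Matrix (A × B) (A × B) ℂ) : ℝ≥0∞ :=
  Filter.liminf (fun n : ℕ => oneShotKey (tensorPower n ρ) / (n : ℝ≥0∞)) Filter.atTop

end QKey

end

/-! The obstruction is monogamy of the key. Let `ω` extend `ρ`, with second marginal `σ` supported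
in `ρ`, and let a one-way protocol `L` send `ρ` to the flagged private state. Since communication
only goes to Bob, both `B` and `B'` can run his part; this gives `τ` with marginals `L ρ` and `L σ`
(`IsOneWayLOCC.exists_extension`).

The support condition, in the form `σ = ρ * M`, means that every outcome of probability zero under
`L ρ` has probability zero under `L σ` (`positive_functional_mul_eq_zero`). So when the flag is 1,
the key of `B'` always equals Alice's. A copy of her key held outside `AB` destroys the coherence
between distinct key values in `L ρ` (`traceB'_apply_eq_zero`), whereas a private state has nonzero
coherence blocks `U_i ω U_j†`. Hence `p = 0` or `k = 1`.

Both hypotheses survive tensor powers, so the one-shot key of every `ρ^{⊗ n}` is exactly zero. -/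

namespace QKey

open Matrix

/-! ### Zeros of positive operators and functionals -/

section PosSemidef

variable {S : Type*} [Fintype S]

open scoped MatrixOrder in
theorem exists_eq_conjTranspose_mul_self [DecidableEq S] {ρ : Matrix S S ℂ} (hρ : ρ.PosSemidef) :
    ∃ C : Matrix S S ℂ, ρ = Cᴴ * C := by
  obtain ⟨C, hC⟩ := CStarAlgebra.nonneg_iff_eq_star_mul_self.mp
    (Matrix.nonneg_iff_posSemidef.mpr hρ)
  exact ⟨C, hC⟩

theorem PosSemidef.apply_eq_zero_right [DecidableEq S] {ρ : Matrix S S ℂ} (hρ : ρ.PosSemidef)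
    {j : S} (hj : ρ j j = 0) (i : S) : ρ i j = 0 := by
  obtain ⟨C, rfl⟩ := exists_eq_conjTranspose_mul_self hρ
  have hcol : ∀ x, C x j = 0 := by
    have h : star (fun x => C x j) ⬝ᵥ (fun x => C x j) = 0 := by
      simpa [Matrix.mul_apply, dotProduct] using hj
    exact fun x => congrFun (dotProduct_star_self_eq_zero.mp h : (fun x => C x j) = 0) x
  simp [Matrix.mul_apply, hcol]

theorem PosSemidef.apply_eq_zero_left [DecidableEq S] {ρ : Matrix S S ℂ} (hρ : ρ.PosSemidef)
    {i : S} (hi : ρ i i = 0) (j : S) : ρ i j = 0 := by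
  rw [← hρ.isHermitian.apply i j, PosSemidef.apply_eq_zero_right hρ hi, star_zero]

/-- A positive functional that vanishes at a positive semidefinite `ρ` vanishes on the right ideal
generated by `ρ`. -/
theorem positive_functional_mul_eq_zero [DecidableEq S] (f : Matrix S S ℂ →ₗ[ℂ] ℂ)
    (hf : ∀ X : Matrix S S ℂ, X.PosSemidef → 0 ≤ f X) {ρ : Matrix S S ℂ} (hρ : ρ.PosSemidef)
    (h0 : f ρ = 0) (M : Matrix S S ℂ) : f (ρ * M) = 0 := by
  obtain ⟨C, rfl⟩ := exists_eq_conjTranspose_mul_self hρ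
  set Y := C * M with hY
  rw [Matrix.mul_assoc, ← hY]
  -- Expand `f` at the positive operator `(Y + tC)ᴴ(Y + tC)`. The term quadratic in `t` drops out
  -- because `f (Cᴴ * C) = 0`, leaving an affine function that must stay nonnegative.
  have key : ∀ t : ℂ, 0 ≤ f (Yᴴ * Y) + (t * f (Yᴴ * C) + star t * f (Cᴴ * Y)) := by
    intro t
    have h := hf _ (posSemidef_conjTranspose_mul_self (Y + t • C))
    have e : (Y + t • C)ᴴ * (Y + t • C) =
        Yᴴ * Y + (t • (Yᴴ * C) + star t • (Cᴴ * Y)) + (t * star t) • (Cᴴ * C) := by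
      simp only [conjTranspose_add, conjTranspose_smul, add_mul, mul_add, Matrix.smul_mul,
        Matrix.mul_smul, smul_smul]
      abel
    rw [e] at h
    simpa [h0] using h
  have lin : ∀ d z : ℂ, (∀ s : ℝ, 0 ≤ d + s * z) → z = 0 := by
    intro d z h
    have him : ∀ s : ℝ, d.im + s * z.im = 0 := fun s => by
      have := (Complex.le_def.mp (h s)).2
      simpa using this.symm
    have hre : ∀ s : ℝ, 0 ≤ d.re + s * z.re := fun s => by
      have := (Complex.le_def.mp (h s)).1
      simpa using this
    refine Complex.ext ?_ ?_
    · by_contra hz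
      have := hre (-(d.re + 1) / z.re)
      rw [div_mul_cancel₀ _ hz] at this
      linarith
    · have h1 := him 1
      have h0 := him 0
      simp only [Complex.zero_im]
      linarith
  -- Real `t` kills the sum of the two cross terms, imaginary `t` their difference.
  have h1 := lin (f (Yᴴ * Y)) (f (Yᴴ * C) + f (Cᴴ * Y)) fun s => by
    have := key s
    simpa [mul_add] using this
  have h2 := lin (f (Yᴴ * Y)) (Complex.I * (f (Yᴴ * C) - f (Cᴴ * Y))) fun s => by
    have := key (s * Complex.I)
    have e : (s * Complex.I : ℂ) * f (Yᴴ * C) + star (s * Complex.I : ℂ) * f (Cᴴ * Y) =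
        s * (Complex.I * (f (Yᴴ * C) - f (Cᴴ * Y))) := by
      simp
      ring
    rwa [e] at this
  have h3 := (mul_eq_zero.mp h2).resolve_left Complex.I_ne_zero
  linear_combination (h1 - h3) / 2

end PosSemidef

/-- This factorised form of support inclusion is multiplicative, so it passes to tensor powers at
once. -/
theorem exists_eq_mul_of_supp_le {S : Type*} [Fintype S] [DecidableEq S] {σ ρ : Matrix S S ℂ}
    (h : supp σ ≤ supp ρ) : ∃ M : Matrix S S ℂ, σ = ρ * M := by
  have hcol : ∀ j, ∃ v : S → ℂ, ρ *ᵥ v = σ.col j := fun j => by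
    have hmem : σ *ᵥ Pi.single j 1 ∈ supp σ := ⟨Pi.single j 1, rfl⟩
    obtain ⟨v, hv⟩ := h hmem
    exact ⟨v, by simpa using hv⟩
  choose v hv using hcol
  refine ⟨Matrix.of fun i j => v j i, ?_⟩
  ext i j
  exact (congrFun (hv j) i).symm

/-! ### Tensor powers of states and of extensions -/

section TensorPower

variable {S : Type*}

/-- The `n`-fold tensor power of an operator on a single system. -/
def piPower (n : ℕ) (M : Matrix S S ℂ) : Matrix (Fin n → S) (Fin n → S) ℂ :=
  Matrix.of fun x y => ∏ i, M (x i) (y i)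

theorem piPower_mul [Fintype S] (n : ℕ) (M N : Matrix S S ℂ) :
    piPower n (M * N) = piPower n M * piPower n N := by
  ext x y
  simp only [piPower, of_apply, Matrix.mul_apply, ← Finset.prod_mul_distrib]
  rw [Finset.prod_univ_sum, Fintype.piFinset_univ]

theorem piPower_conjTranspose (n : ℕ) (M : Matrix S S ℂ) :
    piPower n Mᴴ = (piPower n M)ᴴ := by
  ext x y
  simp [piPower]

theorem piPower_posSemidef [Fintype S] [DecidableEq S] (n : ℕ) {M : Matrix S S ℂ}
    (hM : M.PosSemidef) :
    (piPower n M).PosSemidef := by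
  obtain ⟨C, rfl⟩ := exists_eq_conjTranspose_mul_self hM
  rw [piPower_mul, piPower_conjTranspose]
  exact posSemidef_conjTranspose_mul_self _

variable {A B : Type*}

theorem tensorPower_eq_submatrix (n : ℕ) (ρ : Matrix (A × B) (A × B) ℂ) :
    tensorPower n ρ = (piPower n ρ).submatrix (Equiv.arrowProdEquivProdArrow (Fin n) _ _).symm
      (Equiv.arrowProdEquivProdArrow (Fin n) _ _).symm := rfl

theorem tensorPower_mul [Fintype A] [Fintype B] (n : ℕ) (ρ M : Matrix (A × B) (A × B) ℂ) :
    tensorPower n (ρ * M) = tensorPower n ρ * tensorPower n M := by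
  simp only [tensorPower_eq_submatrix, piPower_mul, submatrix_mul_equiv]

theorem tensorPower_posSemidef [Fintype A] [DecidableEq A] [Fintype B] [DecidableEq B]
    (n : ℕ) {ρ : Matrix (A × B) (A × B) ℂ} (hρ : ρ.PosSemidef) :
    (tensorPower n ρ).PosSemidef :=
  (piPower_posSemidef n hρ).submatrix _

/-- The `n`-fold tensor power of a tripartite operator, regrouped by party. -/
def triPower (n : ℕ) (ω : Matrix (A × B × B) (A × B × B) ℂ) :
    Matrix ((Fin n → A) × (Fin n → B) × (Fin n → B))
      ((Fin n → A) × (Fin n → B) × (Fin n → B)) ℂ :=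
  (piPower n ω).submatrix (fun x i => (x.1 i, x.2.1 i, x.2.2 i))
    (fun x i => (x.1 i, x.2.1 i, x.2.2 i))

theorem traceB'_triPower [Fintype B] (n : ℕ) (ω : Matrix (A × B × B) (A × B × B) ℂ) :
    traceB' (triPower n ω) = tensorPower n (traceB' ω) := by
  ext x y
  simp only [traceB', triPower, piPower, tensorPower, of_apply, submatrix_apply]
  rw [Finset.prod_univ_sum, Fintype.piFinset_univ]

theorem traceB_triPower [Fintype B] (n : ℕ) (ω : Matrix (A × B × B) (A × B × B) ℂ) :
    traceB (triPower n ω) = tensorPower n (traceB ω) := by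
  ext x y
  simp only [traceB, triPower, piPower, tensorPower, of_apply, submatrix_apply]
  rw [Finset.prod_univ_sum, Fintype.piFinset_univ]

end TensorPower

/-! ### Local maps and extensions of their outputs -/

section LocalMaps

/-- The operator `(id_I ⊗ Φ)(X)` for an arbitrary index type `I`. -/
def blockMap {I S T : Type*} (Φ : Matrix S S ℂ →ₗ[ℂ] Matrix T T ℂ)
    (X : Matrix (I × S) (I × S) ℂ) : Matrix (I × T) (I × T) ℂ :=
  Matrix.of fun x y => Φ (Matrix.of fun s t => X (x.1, s) (y.1, t)) x.2 y.2

theorem IsCP.blockMap_posSemidef {I S T : Type*} [Fintype I]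
    {Φ : Matrix S S ℂ →ₗ[ℂ] Matrix T T ℂ} (hΦ : IsCP Φ) {X : Matrix (I × S) (I × S) ℂ}
    (hX : X.PosSemidef) : (blockMap Φ X).PosSemidef := by
  let e := Fintype.equivFin I
  have h := (hΦ _ _ (hX.submatrix (Prod.map e.symm id))).submatrix (Prod.map e id)
  convert h using 1
  ext x y
  simp [blockMap, ampliation]

theorem sum_map_of_apply {ι S T : Type*} [Fintype ι] (Φ : Matrix S S ℂ →ₗ[ℂ] Matrix T T ℂ)
    (G : ι → S → S → ℂ) (x y : T) :
    ∑ c, Φ (Matrix.of fun s t => G c s t) x y = Φ (Matrix.of fun s t => ∑ c, G c s t) x y := by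
  have h : (Matrix.of fun s t => ∑ c, G c s t) = ∑ c, Matrix.of fun s t => G c s t := by
    ext s t
    simp [Matrix.sum_apply]
  rw [h, map_sum, Matrix.sum_apply]

theorem IsTP.sum_map_of_apply {S T : Type*} [Fintype S] [Fintype T]
    {Φ : Matrix S S ℂ →ₗ[ℂ] Matrix T T ℂ} (hΦ : IsTP Φ) (G : S → S → ℂ) :
    ∑ c, Φ (Matrix.of fun s t => G s t) c c = ∑ s, G s s :=
  hΦ (Matrix.of fun s t => G s t)

variable {A A' B B' : Type*}

section TensorMap

variable [Fintype A] [DecidableEq A] [Fintype B] [DecidableEq B]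

/-- The nested form lets positivity and partial traces be treated one tensor factor at a time. -/
theorem tensorMap_apply (E : Matrix A A ℂ →ₗ[ℂ] Matrix A' A' ℂ)
    (D : Matrix B B ℂ →ₗ[ℂ] Matrix B' B' ℂ) (X : Matrix (A × B) (A × B) ℂ) (x y : A' × B') :
    tensorMap E D X x y = E (Matrix.of fun a a' => D (Matrix.of fun b b' => X (a, b) (a', b'))
      x.2 y.2) x.1 y.1 := by
  have hD : ∀ a a', D (Matrix.of fun b b' => X (a, b) (a', b')) x.2 y.2 =
      ∑ b, ∑ b', X (a, b) (a', b') * D (Matrix.single b b' 1) x.2 y.2 := fun a a' => by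
    conv_lhs => rw [matrix_eq_sum_single (Matrix.of fun b b' => X (a, b) (a', b'))]
    simp only [map_sum, Matrix.sum_apply, of_apply]
    refine Finset.sum_congr rfl fun b _ => Finset.sum_congr rfl fun b' _ => ?_
    rw [← mul_one (X (a, b) (a', b')), ← smul_eq_mul, ← smul_single, map_smul]
    simp
  have hE : ∀ G : A → A → ℂ, E (Matrix.of G) x.1 y.1 =
      ∑ a, ∑ a', G a a' * E (Matrix.single a a' 1) x.1 y.1 := fun G => by
    conv_lhs => rw [matrix_eq_sum_single (Matrix.of G)]
    simp only [map_sum, Matrix.sum_apply, of_apply]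
    refine Finset.sum_congr rfl fun a _ => Finset.sum_congr rfl fun a' _ => ?_
    rw [← mul_one (G a a'), ← smul_eq_mul, ← smul_single, map_smul]
    simp
  simp only [hD]
  rw [hE]
  simp only [tensorMap, LinearMap.coe_mk, AddHom.coe_mk, Matrix.sum_apply, Matrix.smul_apply,
    kroneckerMap_apply, smul_eq_mul, Fintype.sum_prod_type, Finset.sum_mul]
  refine Finset.sum_congr rfl fun a _ => ?_
  rw [Finset.sum_comm]
  refine Finset.sum_congr rfl fun a' _ => ?_
  refine Finset.sum_congr rfl fun b _ => Finset.sum_congr rfl fun b' _ => ?_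
  ring

theorem tensorMap_posSemidef [Fintype B'] {E : Matrix A A ℂ →ₗ[ℂ] Matrix A' A' ℂ}
    {D : Matrix B B ℂ →ₗ[ℂ] Matrix B' B' ℂ} (hE : IsCP E) (hD : IsCP D)
    {X : Matrix (A × B) (A × B) ℂ} (hX : X.PosSemidef) : (tensorMap E D X).PosSemidef := by
  have h := (hE.blockMap_posSemidef ((hD.blockMap_posSemidef hX).submatrix Prod.swap)).submatrix
    Prod.swap
  convert h using 1
  ext x y
  exact tensorMap_apply E D X x y

end TensorMap

/-- The operator `(E ⊗ D ⊗ D)(ω)`. -/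
def triMap (E : Matrix A A ℂ →ₗ[ℂ] Matrix A' A' ℂ) (D : Matrix B B ℂ →ₗ[ℂ] Matrix B' B' ℂ)
    (ω : Matrix (A × B × B) (A × B × B) ℂ) : Matrix (A' × B' × B') (A' × B' × B') ℂ :=
  Matrix.of fun x y => E (Matrix.of fun a a' => D (Matrix.of fun b b' => D (Matrix.of fun c c' =>
    ω (a, b, c) (a', b', c')) x.2.2 y.2.2) x.2.1 y.2.1) x.1 y.1

theorem triMap_posSemidef [Fintype A] [Fintype B] [Fintype B']
    {E : Matrix A A ℂ →ₗ[ℂ] Matrix A' A' ℂ}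
    {D : Matrix B B ℂ →ₗ[ℂ] Matrix B' B' ℂ} (hE : IsCP E) (hD : IsCP D)
    {ω : Matrix (A × B × B) (A × B × B) ℂ} (hω : ω.PosSemidef) : (triMap E D ω).PosSemidef := by
  have h1 := hD.blockMap_posSemidef (hω.submatrix (Equiv.prodAssoc A B B))
  have h2 := hD.blockMap_posSemidef (I := A × B')
    (h1.submatrix fun x : (A × B') × B => ((x.1.1, x.2), x.1.2))
  have h3 := hE.blockMap_posSemidef (I := B' × B')
    (h2.submatrix fun x : (B' × B') × A => ((x.2, x.1.2), x.1.1))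
  exact h3.submatrix fun x : A' × B' × B' => (x.2, x.1)

variable [Fintype A] [DecidableEq A] [Fintype B] [DecidableEq B] [Fintype B']

theorem traceB'_triMap (E : Matrix A A ℂ →ₗ[ℂ] Matrix A' A' ℂ)
    {D : Matrix B B ℂ →ₗ[ℂ] Matrix B' B' ℂ} (hD : IsTP D)
    (ω : Matrix (A × B × B) (A × B × B) ℂ) :
    traceB' (triMap E D ω) = tensorMap E D (traceB' ω) := by
  ext x y
  simp only [tensorMap_apply, traceB', triMap, of_apply]
  simp only [QKey.sum_map_of_apply, hD.sum_map_of_apply]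

theorem traceB_triMap (E : Matrix A A ℂ →ₗ[ℂ] Matrix A' A' ℂ)
    {D : Matrix B B ℂ →ₗ[ℂ] Matrix B' B' ℂ} (hD : IsTP D)
    (ω : Matrix (A × B × B) (A × B × B) ℂ) :
    traceB (triMap E D ω) = tensorMap E D (traceB ω) := by
  ext x y
  simp only [tensorMap_apply, traceB, triMap, of_apply]
  rw [QKey.sum_map_of_apply]
  simp only [hD.sum_map_of_apply, QKey.sum_map_of_apply]

theorem IsOneWayLOCC.posSemidef [Fintype A']
    {L : Matrix (A × B) (A × B) ℂ →ₗ[ℂ] Matrix (A' × B') (A' × B') ℂ} (hL : IsOneWayLOCC L)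
    {X : Matrix (A × B) (A × B) ℂ} (hX : X.PosSemidef) : (L X).PosSemidef := by
  obtain ⟨m, E, D, hE, -, hD, rfl⟩ := hL
  rw [LinearMap.sum_apply]
  exact posSemidef_sum _ fun i _ => tensorMap_posSemidef (hE i) (hD i).1 hX

/-- Bob's channel `D_x` is applied to both `B` and `B'`; tracing out either copy removes its channel
by trace preservation. Outcomes `x` are summed because both copies may receive the same message. -/
theorem IsOneWayLOCC.exists_extension [Fintype A']
    {L : Matrix (A × B) (A × B) ℂ →ₗ[ℂ] Matrix (A' × B') (A' × B') ℂ} (hL : IsOneWayLOCC L)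
    {ω : Matrix (A × B × B) (A × B × B) ℂ} (hω : ω.PosSemidef) :
    ∃ τ : Matrix (A' × B' × B') (A' × B' × B') ℂ,
      τ.PosSemidef ∧ traceB' τ = L (traceB' ω) ∧ traceB τ = L (traceB ω) := by
  obtain ⟨m, E, D, hE, -, hD, rfl⟩ := hL
  refine ⟨∑ i, triMap (E i) (D i) ω,
    posSemidef_sum _ fun i _ => triMap_posSemidef (hE i) (hD i).1 hω, ?_, ?_⟩
  · simp only [LinearMap.sum_apply, ← traceB'_triMap (E _) (hD _).2]
    ext x y
    simp only [traceB', of_apply, Matrix.sum_apply]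
    exact Finset.sum_comm
  · simp only [LinearMap.sum_apply, ← traceB_triMap (E _) (hD _).2]
    ext x y
    simp only [traceB, of_apply, Matrix.sum_apply]
    exact Finset.sum_comm

end LocalMaps

/-- If Alice's basis outcomes `x`, `y` are never jointly compatible with an outcome of the second
extension, then the corresponding coherence of the first marginal vanishes. -/
theorem traceB'_apply_eq_zero {A B : Type*} [Fintype A] [DecidableEq A] [Fintype B] [DecidableEq B]
    {τ : Matrix (A × B × B) (A × B × B) ℂ} (hτ : τ.PosSemidef) {x y : A}
    (h : ∀ c, traceB τ (x, c) (x, c) = 0 ∨ traceB τ (y, c) (y, c) = 0) (b b' : B) :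
    traceB' τ (x, b) (y, b') = 0 := by
  have hdiag : ∀ a c, traceB τ (a, c) (a, c) = 0 → ∀ b, τ (a, b, c) (a, b, c) = 0 := by
    intro a c hac b
    exact (Finset.sum_eq_zero_iff_of_nonneg fun d _ => hτ.diag_nonneg).mp hac b (Finset.mem_univ b)
  refine Finset.sum_eq_zero fun c _ => ?_
  -- A zero diagonal entry of a positive operator annihilates its whole row and column.
  rcases h c with hx | hy
  · exact PosSemidef.apply_eq_zero_left hτ (hdiag _ _ hx _) _
  · exact PosSemidef.apply_eq_zero_right hτ (hdiag _ _ hy _) _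

/-! ### Private states and the monogamy contradiction -/

section PrivateState

variable {k a b : ℕ}
  {γ : Matrix ((Fin k × Fin a) × (Fin k × Fin b)) ((Fin k × Fin a) × (Fin k × Fin b)) ℂ}

theorem flagged_one_apply {A' B' : Type*} [Fintype A'] [DecidableEq A'] [Fintype B']
    [DecidableEq B'] (p : ℝ) (γ : Matrix (A' × B') (A' × B') ℂ) (x x' : A') (y y' : B') :
    flagged p γ ((1, x), y) ((1, x'), y') = p * γ (x, y) (x', y') := by
  simp [flagged, proj]

theorem IsPrivateState.apply_diag_eq_zero (hγ : IsPrivateState k a b γ) {i j : Fin k} (hij : i ≠ j)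
    (s : Fin a) (t : Fin b) : γ ((i, s), (j, t)) ((i, s), (j, t)) = 0 := by
  obtain ⟨-, ω, U, -, rfl⟩ := hγ
  have : ∀ c : Fin k, (c, c) ≠ (i, j) := fun c h => by
    rw [Prod.mk.injEq] at h
    exact hij (h.1.symm.trans h.2)
  simp [Matrix.sum_apply, this]

/-- Unitaries can be cancelled from `U_i ω U_j†`, so a vanishing block would force `ω = 0`, against
unit trace. -/
theorem IsPrivateState.exists_offDiag_ne_zero (hγ : IsPrivateState k a b γ) (i j : Fin k) :
    ∃ s t s' t', γ ((i, s), (i, t)) ((j, s'), (j, t')) ≠ 0 := by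
  obtain ⟨hk, ω, U, hω, rfl⟩ := hγ
  by_contra! h
  have hk' : (k : ℂ) ≠ 0 := by exact_mod_cast (by omega : k ≠ 0)
  have hz : (U i : Matrix (Fin a × Fin b) (Fin a × Fin b) ℂ) * ω *
      (U j : Matrix (Fin a × Fin b) (Fin a × Fin b) ℂ).conjTranspose = 0 := by
    ext ⟨s, t⟩ ⟨s', t'⟩
    have := h s t s' t'
    simpa [Matrix.sum_apply, Matrix.single_apply, hk', ite_and] using this
  have hUi : (U i : Matrix (Fin a × Fin b) (Fin a × Fin b) ℂ)ᴴ * U i = 1 :=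
    mem_unitaryGroup_iff'.mp (U i).2
  have hUj : (U j : Matrix (Fin a × Fin b) (Fin a × Fin b) ℂ)ᴴ * U j = 1 :=
    mem_unitaryGroup_iff'.mp (U j).2
  have hω0 : ω = 0 := calc
    ω = ((U i : Matrix (Fin a × Fin b) (Fin a × Fin b) ℂ)ᴴ * U i) * ω *
        ((U j : Matrix (Fin a × Fin b) (Fin a × Fin b) ℂ)ᴴ * U j) := by simp [hUi, hUj]
    _ = (U i : Matrix (Fin a × Fin b) (Fin a × Fin b) ℂ)ᴴ * ((U i :
        Matrix (Fin a × Fin b) (Fin a × Fin b) ℂ) * ω * (U j :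
        Matrix (Fin a × Fin b) (Fin a × Fin b) ℂ)ᴴ) * U j := by simp only [Matrix.mul_assoc]
    _ = 0 := by rw [hz]; simp
  have := hω.2
  simp [hω0] at this

end PrivateState

/-- No one-way LOCC channel distils a nontrivial private state from a positive operator that has an
extension whose second marginal is supported in the operator itself. -/
theorem oneShotKey_eq_zero {A B : Type*} [Fintype A] [DecidableEq A] [Fintype B] [DecidableEq B]
    {ρ M : Matrix (A × B) (A × B) ℂ} {ω : Matrix (A × B × B) (A × B × B) ℂ} (hρ : ρ.PosSemidef)
    (hω : ω.PosSemidef) (h1 : traceB' ω = ρ) (h2 : traceB ω = ρ * M) : oneShotKey ρ = 0 := by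
  refine le_antisymm (sSup_le ?_) zero_le
  rintro r ⟨p, k, a, b, γ, L, hp0, -, hγ, hL, hLρ, rfl⟩
  suffices p = 0 ∨ k ≤ 1 by
    rcases this with rfl | hk
    · simp
    · obtain rfl : k = 1 := le_antisymm hk hγ.1
      simp
  by_contra! hcon
  obtain ⟨hp, hk⟩ := hcon
  obtain ⟨τ, hτ, hτ1, hτ2⟩ := hL.exists_extension hω
  rw [h1, hLρ] at hτ1
  rw [h2] at hτ2
  have hdiag : ∀ v, flagged p γ v v = 0 → traceB τ v v = 0 := by
    intro v hv
    rw [hτ2]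
    -- A diagonal entry of `L X` is a positive functional of `X`.
    exact positive_functional_mul_eq_zero ((entryLinearMap ℂ ℂ v v).comp L)
      (fun X hX => (hL.posSemidef hX).diag_nonneg) hρ (by simpa [hLρ] using hv) M
  have hcorr : ∀ (i j : Fin k) (s : Fin a) (t : Fin b), i ≠ j →
      traceB τ ((1, (i, s)), (j, t)) ((1, (i, s)), (j, t)) = 0 := fun i j s t hij =>
    hdiag _ (by rw [flagged_one_apply, hγ.apply_diag_eq_zero hij, mul_zero])
  let i : Fin k := ⟨0, by omega⟩
  let j : Fin k := ⟨1, hk⟩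
  have hij : i ≠ j := by simp [i, j]
  obtain ⟨s, t, s', t', hne⟩ := hγ.exists_offDiag_ne_zero i j
  have hzero := traceB'_apply_eq_zero hτ (x := ((1 : Fin 2), (i, s))) (y := ((1 : Fin 2), (j, s')))
    (fun c => by
      obtain ⟨l, u⟩ := c
      -- The key value `l` of the second Bob cannot agree with both `i` and `j`.
      by_cases hl : i = l
      · exact Or.inr (hcorr j l s' u (hl ▸ hij.symm))
      · exact Or.inl (hcorr i l s u hl)) (i, t) (j, t')
  rw [hτ1, flagged_one_apply] at hzero
  exact (mul_ne_zero (by exact_mod_cast hp) hne) hzero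

end QKey

theorem theorem1 {A B : Type*} [Fintype A] [DecidableEq A] [Fintype B] [DecidableEq B]
    (ρ : Matrix (A × B) (A × B) ℂ) (hρ : QKey.IsState ρ) (hext : QKey.IsSuperTwoExtendible ρ) :
    QKey.distillableKey ρ = 0 := by
  obtain ⟨σ, ⟨ω, hω, h1, h2⟩, hsupp⟩ := hext
  obtain ⟨M, hM⟩ := QKey.exists_eq_mul_of_supp_le hsupp
  have key : ∀ n, QKey.oneShotKey (QKey.tensorPower n ρ) = 0 := fun n =>
    QKey.oneShotKey_eq_zero (M := QKey.tensorPower n M) (ω := QKey.triPower n ω)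
      (QKey.tensorPower_posSemidef n hρ.1) ((QKey.piPower_posSemidef n hω.1).submatrix _)
      (by rw [QKey.traceB'_triPower, h1])
      (by rw [QKey.traceB_triPower, h2, hM, QKey.tensorPower_mul])
  simp [QKey.distillableKey, key]
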